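/- \textbf{Trees.} A bicoloured tree is a finite rooted plane tree each of whose vertices is white or black. For a vertex $x$ of $\tau$, let $\tau^x$ be the subtree formed by $x$ and its descendants, $p(x)$ the parent of $x$ and $r(x)$ its rightmost child; $\tau\setminus\tau^x$ is $\tau$ with $\tau^x$ erased. Let $\tau^\circ$ be the tree obtained from $\tau$ by recolouring its root white and adding a white leaf as rightmost child of the root. \textbf{The infinite tree.} $T_\infty$ is the critical geometric Galton--Watson tree conditioned to survive, uniformly bicoloured: to the vertices $v_0,v_1,\dots$ of an infinite path (the spine, rooted at $v_0$) one attaches, for each $i\ge 0$, a tree $\lambda^i$ to the left and a tree $\rho^i$ to the right, by identifying their roots with $v_i$, where all the $\lambda^i,\rho^i$ are independent Galton--Watson trees with offspring distribution $\mu(k)=2^{-k-1}$, $k\ge0$; then every vertex is independently coloured black or white with probability $1/2$. Let $cut_n(T_\infty)=(\tau,v_n)$, where $\tau$ is obtained from $T_\infty$ by erasing the descendants of $v_n$ lying strictly to the left of $v_{n+1}$, together with $v_{n+1}$ and all its descendants. \textbf{The algorithm.} It runs on triples $(\tau,x,s)$, where $x$ is a vertex of the bicoloured tree $\tau$ and $s\in\Sigma=\{w_0,w_{>0},b,j\}$.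 The natural state of $x$ in $\tau$ is $w_0$ if $x$ is a white leaf, $w_{>0}$ if $x$ is white and has children, $b$ if $x$ is black. Started on a pair $(\tau,x)$, the algorithm first erases from $\tau$ all the vertices lying strictly to the left of the path from the root to $x$, which gives $(\tau_0,x_0)$ with $x_0=x$, and $s_0$ is the natural state of $x_0$ in $\tau_0$. Then $(\tau_{i+1},x_{i+1},s_{i+1})=(\tau',x',s')$ is obtained from $(\tau,x,s)=(\tau_i,x_i,s_i)$ as follows, $s'$ being the natural state of $x'$ in $\tau'$ unless $s'=j$ is specified; when two vertices are identified, the resulting vertex is white if and only if both were white. \begin{itemize} \item $s=w_0$: $\tau'=\tau\setminus\tau^x$ and $x'=p(x)$. \item $s=w_{>0}$: if $x$ has a right sibling, $\tau'=\tau\setminus\tau^x$ and $x'=p(x)$. Otherwise, $\tau'$ is obtained by erasing $\tau^x$ and re-attaching $\tau^{r(x)}$ with $r(x)$ identified with $p(x)$; $x'$ is the merged vertex. \item $s=b$: if $x$ has at least two right siblings, $\tau'=\tau\setminus\tau^x$ and $x'=p(x)$. If $x$ has exactly one right sibling $y$, $\tau'$ is obtained by erasing $\tau^x$ and identifying $y$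 with $p(x)$; $x'$ is the merged vertex. If $x$ has no right sibling, apply the jump rule. \item $s=j$: apply the jump rule. \item Jump rule: if $p(x)$ has right siblings, $x'$ is the leftmost of them and $\tau'=\tau\setminus\tau^{p(x)}$; otherwise $\tau'=\tau\setminus\tau^x$, $x'=p(x)$ and $s'=j$. \end{itemize} \textbf{Proposition.} There is a Markov chain $(X_i)_{i\ge0}$ on $\Sigma$ with transition matrix (rows and columns in the order $w_0,w_{>0},b,j$) $$M=\begin{pmatrix}1/4&1/4&1/2&0\\ 1/16&5/16&5/8&0\\ 3/32&7/32&7/16&1/4\\ 1/8&1/8&1/4&1/2\end{pmatrix}$$ and initial law $(1/4,1/4,1/2,0)$ such that, for every $n>0$, if $(\tau,x)=cut_n(T_\infty)$ and the algorithm is started on $(\tau^\circ,x)$, then its first $n-1$ states $s_0,\dots,s_{n-2}$ are well defined (almost surely) and $(s_0,\dots,s_{n-2})$ has the same law as $(X_0,\dots,X_{n-2})$. -/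

import Mathlib

open MeasureTheory ProbabilityTheory
open scoped ENNReal

namespace GeodesicAlgorithm

/-! ### Bicoloured plane trees -/

/-- The two colours of vertices. -/
inductive Colour
  | white
  | black
  deriving DecidableEq

instance : Fintype Colour := ⟨{.white, .black}, fun c => by cases c <;> simp⟩
instance : Nonempty Colour := ⟨.white⟩
instance : MeasurableSpace Colour := ⊤

/-- Finite bicoloured rooted plane trees: a root with its colour and the list, from left to right,
of the subtrees formed by the children of the root and their descendants. -/
inductive BTree
  | node (colour : Colour) (children : List BTree)

instance : MeasurableSpace BTree := ⊤

namespace BTree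

/-- The colour of the root. -/
def colour : BTree → Colour
  | node c _ => c

/-- The subtrees attached to the root, from left to right. -/
def children : BTree → List BTree
  | node _ l => l

/-- The number of vertices. -/
def size : BTree → ℕ
  | node _ l => 1 + (l.map size).sum

/-- The probability `∏ₓ 2 ^ (-c(x) - 1)` that a Galton-Watson tree with offspring distribution
`μ(k) = 2 ^ (-k - 1)` is equal to the tree in which the colours are forgotten;
`x` ranges over the vertices and `c(x)` is the number of children of `x`. -/
noncomputable def gwWeight : BTree → ℝ≥0∞
  | node _ l => 2⁻¹ ^ (l.length + 1) * (l.map gwWeight).prod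

/-- The probability of a bicoloured tree under the law of the uniformly bicoloured critical
geometric Galton-Watson tree: given the shape, each colouring of its vertices has the same
probability. -/
noncomputable def bgwWeight (t : BTree) : ℝ≥0∞ := gwWeight t * 2⁻¹ ^ size t

lemma bgwWeight_node (c : Colour) (l : List BTree) :
    bgwWeight (node c l) = 2⁻¹ ^ 2 * (2⁻¹ ^ l.length * (l.map bgwWeight).prod) := by
  have key : ∀ m : List BTree, (m.map bgwWeight).prod =
      (m.map gwWeight).prod * 2⁻¹ ^ (m.map size).sum := by
    intro m
    induction m with
    | nil => simp
    | cons a m ih =>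
      simp only [List.map_cons, List.prod_cons, List.sum_cons, ih, bgwWeight, pow_add]
      ring
  rw [key, bgwWeight, gwWeight, size]
  ring

end BTree

/-- A sum over lists of a product of weights is a geometric series. -/
lemma tsum_list_weight {α : Type*} (w : α → ℝ≥0∞) (a : ℝ≥0∞) :
    ∑' l : List α, a ^ l.length * (l.map w).prod = ∑' k : ℕ, (a * ∑' x, w x) ^ k := by
  have hfin : ∀ k : ℕ, ∑' v : Fin k → α, ∏ i, w (v i) = (∑' x, w x) ^ k := by
    intro k
    induction k with
    | zero => simp
    | succ k ih =>
      rw [← (Fin.consEquiv fun _ : Fin (k + 1) => α).tsum_eq, ENNReal.tsum_prod']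
      simp only [Fin.consEquiv_apply, Fin.prod_univ_succ, Fin.cons_zero, Fin.cons_succ,
        ENNReal.tsum_mul_left, ih, ENNReal.tsum_mul_right]
      rw [pow_succ']
  rw [← (List.equivSigmaTuple (α := α)).symm.tsum_eq, ENNReal.tsum_sigma']
  refine tsum_congr fun k => ?_
  have : ∀ v : Fin k → α, a ^ (List.equivSigmaTuple.symm ⟨k, v⟩).length *
      ((List.equivSigmaTuple.symm ⟨k, v⟩).map w).prod = a ^ k * ∏ i, w (v i) := by
    intro v
    simp [List.equivSigmaTuple, List.map_ofFn, List.prod_ofFn]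
  simp_rw [this, ENNReal.tsum_mul_left, hfin, mul_pow]

/-- The trees are the pairs formed by a colour and a list of trees. -/
def BTree.equivProd : Colour × List BTree ≃ BTree where
  toFun p := .node p.1 p.2
  invFun t := (t.colour, t.children)
  left_inv _ := rfl
  right_inv t := by cases t; rfl

lemma tsum_node (f : BTree → ℝ≥0∞) (w : BTree → ℝ≥0∞)
    (h : ∀ c l, f (.node c l) = 2⁻¹ ^ 2 * (2⁻¹ ^ l.length * (l.map w).prod)) :
    ∑' t, f t = 2⁻¹ * (1 - 2⁻¹ * ∑' t, w t)⁻¹ := by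
  rw [← BTree.equivProd.tsum_eq, ENNReal.tsum_prod']
  have : ∀ c l, f (BTree.equivProd (c, l)) = 2⁻¹ ^ 2 * (2⁻¹ ^ l.length * (l.map w).prod) := h
  simp_rw [this, ENNReal.tsum_mul_left, tsum_list_weight, ENNReal.tsum_geometric]
  rw [tsum_fintype]
  have h2 : (Finset.univ : Finset Colour).card = 2 := rfl
  rw [Finset.sum_const, h2, nsmul_eq_mul, ← mul_assoc]
  refine congrArg (· * (1 - 2⁻¹ * ∑' t, w t)⁻¹) ?_
  rw [mul_comm]
  rw [pow_two, ← mul_assoc, Nat.cast_ofNat, ENNReal.mul_inv_cancel (by simp) (by simp), one_mul]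

/-- The weights restricted to the trees of height less than `h`. -/
noncomputable def truncWeight : ℕ → BTree → ℝ≥0∞
  | 0, _ => 0
  | h + 1, .node _ l => 2⁻¹ ^ 2 * (2⁻¹ ^ l.length * (l.map (truncWeight h)).prod)

lemma tsum_truncWeight_le (h : ℕ) : ∑' t, truncWeight h t ≤ 1 := by
  induction h with
  | zero => simp [truncWeight]
  | succ h ih =>
    rw [tsum_node (truncWeight (h + 1)) (truncWeight h) (fun c l => by rw [truncWeight])]
    have h1 : (2⁻¹ : ℝ≥0∞) ≤ 1 - 2⁻¹ * ∑' t, truncWeight h t := by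
      have : (2⁻¹ : ℝ≥0∞) * ∑' t, truncWeight h t ≤ 2⁻¹ := by
        simpa using mul_le_mul_right ih (2⁻¹ : ℝ≥0∞)
      calc (2⁻¹ : ℝ≥0∞) = 1 - 2⁻¹ := by rw [ENNReal.one_sub_inv_two]
        _ ≤ _ := tsub_le_tsub_left this 1
    calc (2⁻¹ : ℝ≥0∞) * (1 - 2⁻¹ * ∑' t, truncWeight h t)⁻¹
        ≤ 2⁻¹ * (2⁻¹)⁻¹ := by gcongr
      _ = 1 := ENNReal.mul_inv_cancel (by simp) (by simp)

lemma exists_truncWeight_eq (t : BTree) :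
    ∃ h₀, ∀ h, h₀ ≤ h → truncWeight h t = t.bgwWeight := by
  induction t using BTree.rec
    (motive_2 := fun l => ∃ h₀, ∀ h, h₀ ≤ h →
      l.map (truncWeight h) = l.map BTree.bgwWeight) with
  | node c l ih =>
    obtain ⟨h₀, hh⟩ := ih
    refine ⟨h₀ + 1, fun h hle => ?_⟩
    obtain ⟨h, rfl⟩ : ∃ k, h = k + 1 := ⟨h - 1, by omega⟩
    rw [truncWeight, hh h (by omega), BTree.bgwWeight_node]
  | nil => exact ⟨0, fun _ _ => rfl⟩
  | cons a l iha ihl =>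
    obtain ⟨h₀, hh⟩ := iha
    obtain ⟨h₁, hh'⟩ := ihl
    refine ⟨max h₀ h₁, fun h hle => ?_⟩
    rw [List.map_cons, List.map_cons, hh h (le_of_max_le_left hle),
      hh' h (le_of_max_le_right hle)]

lemma tsum_bgwWeight_le : ∑' t, BTree.bgwWeight t ≤ 1 := by
  rw [ENNReal.tsum_eq_iSup_sum]
  refine iSup_le fun F => ?_
  choose g hg using exists_truncWeight_eq
  calc ∑ t ∈ F, t.bgwWeight = ∑ t ∈ F, truncWeight (F.sup g) t :=
        Finset.sum_congr rfl fun t ht => (hg t _ (Finset.le_sup ht)).symm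
    _ ≤ ∑' t, truncWeight (F.sup g) t := ENNReal.sum_le_tsum F
    _ ≤ 1 := tsum_truncWeight_le _

/-- Critical Galton-Watson trees are almost surely finite: the weights add up to one. -/
lemma tsum_bgwWeight : ∑' t, BTree.bgwWeight t = 1 := by
  have hle := tsum_bgwWeight_le
  have heq := tsum_node BTree.bgwWeight BTree.bgwWeight BTree.bgwWeight_node
  generalize ∑' t, BTree.bgwWeight t = W at hle heq ⊢
  have hne : W ≠ ∞ := ne_top_of_le_ne_top ENNReal.one_ne_top hle
  lift W to NNReal using hne
  have hW : (W : ℝ) ≤ 1 := by exact_mod_cast hle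
  have hr : (W : ℝ) = 2⁻¹ * (1 - 2⁻¹ * (W : ℝ))⁻¹ := by
    have h1 : (2⁻¹ : ℝ≥0∞) * W ≤ 1 :=
      (mul_le_mul' (by simp : (2⁻¹ : ℝ≥0∞) ≤ 1) hle).trans (by simp)
    have := congrArg ENNReal.toReal heq
    rw [ENNReal.toReal_mul, ENNReal.toReal_inv, ENNReal.toReal_inv,
      ENNReal.toReal_sub_of_le h1 (by simp), ENNReal.toReal_mul] at this
    simpa using this
  have hpos : (1 - 2⁻¹ * (W : ℝ)) ≠ 0 := by linarith
  have h1 : (W : ℝ) * (1 - 2⁻¹ * (W : ℝ)) = 2⁻¹ := by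
    nth_rewrite 1 [hr]
    rw [mul_assoc, inv_mul_cancel₀ hpos, mul_one]
  have h2 : (W : ℝ) = 1 := by nlinarith [sq_nonneg ((W : ℝ) - 1)]
  exact_mod_cast h2

/-- The law of the uniformly bicoloured critical geometric Galton-Watson tree. -/
noncomputable def bgw : PMF BTree :=
  ⟨BTree.bgwWeight, tsum_bgwWeight ▸ ENNReal.summable.hasSum⟩

/-! ### The infinite tree -/

/-- A vertex `v` on a distinguished path that starts at the root, where the path goes on to a
child `v'` of `v`: the colour of `v`, and the subtrees of the children of `v` to the left and to the
right of `v'`, both lists being ordered from left to right. -/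
structure PathVertex where
  colour : Colour
  left : List BTree
  right : List BTree

instance : MeasurableSpace PathVertex := ⊤

/-- Bicoloured infinite plane trees made of an infinite path `v₀ v₁ …` that starts at the root (the
spine) and of finite trees attached to its left and to its right: the `i`-th term is the vertex
`vᵢ` with what is attached to it. -/
abbrev SpineTree : Type := ℕ → PathVertex

/-- The roots of `lam` (on the left) and of `rho` (on the right) are identified with a vertex of the
spine of colour `c`. -/
def attach (c : Colour) (lam rho : BTree) : PathVertex := ⟨c, lam.children, rho.children⟩

/-- The law of `T_∞`, the uniformly bicoloured critical geometric Galton-Watson tree conditioned to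
survive: to the vertices `vᵢ` of the spine, coloured uniformly at random, one attaches Galton-Watson
trees `λⁱ` (on the left) and `ρⁱ` (on the right), bicoloured uniformly, and everything is
independent. (The colours of the roots of `λⁱ` and `ρⁱ` are overridden by the colour of `vᵢ`.) -/
noncomputable def tInftyLaw : Measure SpineTree :=
  (Measure.infinitePi fun _ : ℕ =>
      (PMF.uniformOfFintype Colour).toMeasure.prod (bgw.toMeasure.prod bgw.toMeasure)).map
    fun ω i => attach (ω i).1 (ω i).2.1 (ω i).2.2

/-- A pair `(τ, x)`, where `τ` is a finite bicoloured plane tree and `x` is a vertex of `τ`, as the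
subtree `τ^x` formed by `x` and its descendants, together with the ancestors
`p(x), p(p(x)), …` of `x`, in this order, down to the root, each with its children lying to the left
and to the right of the path from the root to `x`. The height of `x` is the length of this list. -/
structure PointedTree where
  subtree : BTree
  ancestors : List PathVertex

/-- `cut_n(T)`: the vertex `v_n`, in the finite tree obtained by erasing the descendants of `v_n`
which lie strictly to the left of `v_{n+1}`, and `v_{n+1}` with all its descendants. -/
def cut (n : ℕ) (T : SpineTree) : PointedTree :=
  ⟨.node (T n).colour (T n).right, (List.range n).reverse.map T⟩

/-- A leaf of colour white. -/
def whiteLeaf : BTree := .node .white []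

/-- The root is recoloured white, and a white leaf is added as its rightmost child; here the root is
the last vertex of a nonempty list of ancestors. -/
def circAncestors : List PathVertex → List PathVertex
  | [] => []
  | [v] => [⟨.white, v.left, v.right ++ [whiteLeaf]⟩]
  | v :: v' :: l => v :: circAncestors (v' :: l)

/-- From `(τ, x)` to `(τ°, x)`: the root is recoloured white, and a white leaf is added as its
rightmost child. -/
def circ : PointedTree → PointedTree
  | ⟨t, []⟩ => ⟨.node .white (t.children ++ [whiteLeaf]), []⟩
  | ⟨t, l⟩ => ⟨t, circAncestors l⟩

/-- Erase all the vertices that lie strictly to the left of the path from the root to the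
distinguished vertex. -/
def trimLeft (p : PointedTree) : PointedTree :=
  ⟨p.subtree, p.ancestors.map fun v => ⟨v.colour, [], v.right⟩⟩

/-! ### The algorithm -/

/-- The states of the algorithm: `w₀`, `w_{>0}`, `b`, and `j` (jump). -/
inductive State
  | w0
  | wPos
  | b
  | j
  deriving DecidableEq

instance : Fintype State := ⟨{.w0, .wPos, .b, .j}, fun s => by cases s <;> simp⟩
instance : MeasurableSpace State := ⊤
instance : MeasurableSpace (Option State) := ⊤

/-- The state, other than `j`, of the vertex `x` in `τ`, which depends on `τ^x` only: `w₀` for a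
white leaf, `w_{>0}` for a white vertex with offspring, `b` for a black vertex. -/
def vertexState : BTree → State
  | .node .white [] => .w0
  | .node .white (_ :: _) => .wPos
  | .node .black _ => .b

/-- The colour of the vertex obtained by identifying two vertices: white if and only if both
are white. -/
def mergeColour : Colour → Colour → Colour
  | .white, .white => .white
  | _, _ => .black

/-- The triples `(τ, x, s)` on which the algorithm runs. -/
structure Triple where
  pointed : PointedTree
  state : State

/-- The triple `(τ, x, s)` where `s` is chosen among `w₀`, `w_{>0}`, `b` according to `x`. -/
def land (p : PointedTree) : Triple := ⟨p, vertexState p.subtree⟩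

/-- The pair `(τ ∖ τ^x, p(x))`, where `v` is `p(x)` and `l` is the list of the ancestors of `v`. -/
def eraseToParent (v : PathVertex) (l : List PathVertex) : PointedTree :=
  ⟨.node v.colour (v.left ++ v.right), l⟩

/-- Erase `τ^x` and identify `p(x)` (which is `v`, with list of ancestors `l`) with the root of
the tree `t`, in the case where no other child of `p(x)` is to the right of `x`: the children
of the vertex obtained are those of `t`, to the right of what is left of `p(x)`. -/
def mergeToParent (v : PathVertex) (l : List PathVertex) (t : BTree) : PointedTree :=
  ⟨.node (mergeColour v.colour t.colour) (v.left ++ t.children), l⟩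

/-- The rule for jumps, where `v` is `p(x)` and `l` is the list of the ancestors of `v`, the first
of which is `p(p(x))`.
If `p(x)` has right siblings, then erase `τ^{p(x)}` and land on the leftmost of them;
otherwise output `(τ ∖ τ^x, p(x), j)`. `none` if `p(x)` is the root. -/
def jump (v : PathVertex) : List PathVertex → Option Triple
  | [] => none
  | g :: l =>
    match g.right with
    | [] => some ⟨eraseToParent v (g :: l), .j⟩
    | t :: r => some (land ⟨t, ⟨g.colour, g.left, r⟩ :: l⟩)

/-- One step of the algorithm on `(τ, x, s)`, where `v` is `p(x)`:
* `w₀`: output `(τ ∖ x, p(x))`;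
* `w_{>0}`: if `x` has right siblings, output `(τ ∖ τ^x, p(x))`; otherwise erase `τ^x` except for the
  subtree of the rightmost child `r(x)` of `x`, and identify `r(x)` with `p(x)`;
* `b`: if `x` has at least two right siblings, output `(τ ∖ τ^x, p(x))`; if it has exactly one,
  erase `τ^x` and identify that sibling with `p(x)`; if it has none, jump;
* `j`: jump.
`none` if the algorithm is not defined on the triple; this does not happen to the triples
obtained from a well bicoloured tree before the root is reached. -/
def step : Triple → Option Triple
  | ⟨⟨_, []⟩, _⟩ => none
  | ⟨⟨_, v :: l⟩, .w0⟩ => some (land (eraseToParent v l))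
  | ⟨⟨x, v :: l⟩, .wPos⟩ =>
    match v.right with
    | _ :: _ => some (land (eraseToParent v l))
    | [] => x.children.getLast?.map fun r => land (mergeToParent v l r)
  | ⟨⟨_, v :: l⟩, .b⟩ =>
    match v.right with
    | _ :: _ :: _ => some (land (eraseToParent v l))
    | [t] => some (land (mergeToParent v l t))
    | [] => jump v l
  | ⟨⟨_, v :: l⟩, .j⟩ => jump v l

/-- The `i`-th triple `(τ_i, x_i, s_i)` of the algorithm started on `(τ, x)`, if it is defined:
`τ_0` is `τ` deprived of all that lies left of the path from the root to `x`, and `x_0 = x`. -/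
def run (p : PointedTree) : ℕ → Option Triple
  | 0 => some (land (trimLeft p))
  | i + 1 => (run p i).bind step

/-- The `i`-th state of the algorithm started on `(τ, x)`, if it is defined. -/
def runState (p : PointedTree) (i : ℕ) : Option State := (run p i).map Triple.state

/-! ### Markov chains -/

/-- `X` is a Markov chain under `Q`, with initial law `ν` and transition matrix `M`: given a past
`X₀ = a₀, …, X_m = a_m`, the next state is `a_{m+1}` with probability `M (a_m) (a_{m+1})`
(multiplied by the probability of the past, so that nothing is asked if it is zero). -/
structure IsMarkovChain {Ω S : Type*} [MeasurableSpace Ω] [MeasurableSpace S] (Q : Measure Ω)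
    (X : ℕ → Ω → S) (ν : S → ℝ) (M : Matrix S S ℝ) : Prop where
  measurable : ∀ i, Measurable (X i)
  initial : ∀ a, Q.real {ω | X 0 ω = a} = ν a
  transition : ∀ (m : ℕ) (a : ℕ → S),
    Q.real {ω | ∀ i ≤ m + 1, X i ω = a i} =
      Q.real {ω | ∀ i ≤ m, X i ω = a i} * M (a m) (a (m + 1))

/-- The initial law `(1/4, 1/4, 1/2, 0)` on `w₀, w_{>0}, b, j`. -/
noncomputable def initialLaw : State → ℝ
  | .w0 => 1 / 4
  | .wPos => 1 / 4
  | .b => 1 / 2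
  | .j => 0

/-- The transition matrix; rows and columns are listed in the order `w₀, w_{>0}, b, j`. -/
noncomputable def transitionMatrix : Matrix State State ℝ
  | .w0 => fun | .w0 => 1 / 4 | .wPos => 1 / 4 | .b => 1 / 2 | .j => 0
  | .wPos => fun | .w0 => 1 / 16 | .wPos => 5 / 16 | .b => 5 / 8 | .j => 0
  | .b => fun | .w0 => 3 / 32 | .wPos => 7 / 32 | .b => 7 / 16 | .j => 1 / 4
  | .j => fun | .w0 => 1 / 8 | .wPos => 1 / 8 | .b => 1 / 4 | .j => 1 / 2

end GeodesicAlgorithm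

/-!
The height of the current vertex decreases by one at each step of the algorithm, and a step looks at
the current vertex `x`, its parent `p(x)` with the right siblings of `x`, and, when it jumps, the
right siblings of `p(x)`. Hence the states `s_0, …, s_{n-2}` depend only on the vertices
`v_n, …, v_1` of the spine and on what is attached to their right; neither the recoloured root nor
its new leaf plays a role.

What makes the sequence of states a Markov chain is that each rule forgets almost everything about
the explored part. In the states `w₀` and `b` the next step ignores `τ^x`; in the state `w_{>0}` it
reads only the subtree of the rightmost child of `x`, which is a Galton-Watson tree independent of
the rest (`treeMean_forestMean_getLast`); in the state `j` it ignores `τ^x` and all the children of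
`p(x)`. On the other hand, a geometric list of trees is memoryless (`forestMean_eq`), so a vertex on
which a jump has used up the first right subtree is again distributed as a vertex of the spine. The
structure `FollowsChain` records this: from each state, with the irrelevant data fixed arbitrarily
and independent ancestors, the probability to go on through a given sequence of states is the one of
the chain. It is proved by induction on the sequence in `followsChain`, where the entries of the
matrix come out of the lemmas on `IsLandingValue`, one per row. The first triple is the one that the
rule for `w₀` yields from a fictitious child of `v_n` (`run_cut_zero`), and so the initial law is
the row `w₀`.

Independence on the infinite product is used through `lintegral_infinitePi_of_dependsOn`, which
peels off the vertices of the spine one at a time. The Markov chain itself is realized by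
independent random maps `State → State` applied one after the other.
-/

namespace GeodesicAlgorithm

open scoped NNReal

/-! ### Expectations as sums over trees and forests -/

/-- The expectation of `f` at a uniformly bicoloured critical geometric Galton-Watson tree. -/
noncomputable def treeMean (f : BTree → ℝ≥0∞) : ℝ≥0∞ := ∑' t, t.bgwWeight * f t

/-- The expectation of `f` at the list of the subtrees attached to the root of such a tree: a list
of geometric length of independent Galton-Watson trees. -/
noncomputable def forestMean (f : List BTree → ℝ≥0∞) : ℝ≥0∞ :=
  ∑' l : List BTree, 2⁻¹ * (2⁻¹ ^ l.length * (l.map BTree.bgwWeight).prod) * f l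

/-- The expectation of `f` at a vertex of the spine, once everything on its left is erased. -/
noncomputable def vertexMean (f : PathVertex → ℝ≥0∞) : ℝ≥0∞ :=
  2⁻¹ * forestMean (fun l => f ⟨.white, [], l⟩) + 2⁻¹ * forestMean (fun l => f ⟨.black, [], l⟩)

/-- The expectation of `f` at a list of ancestors formed by `k` independent vertices of the spine
(with everything on their left erased) followed by the deterministic list `tail`. -/
noncomputable def lineMean (tail : List PathVertex) : ℕ → (List PathVertex → ℝ≥0∞) → ℝ≥0∞
  | 0, f => f tail
  | k + 1, f => vertexMean fun v => lineMean tail k fun l => f (v :: l)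

lemma treeMean_add (f g : BTree → ℝ≥0∞) :
    treeMean (fun t => f t + g t) = treeMean f + treeMean g := by
  simp only [treeMean, mul_add, ENNReal.tsum_add]

lemma treeMean_const_mul (a : ℝ≥0∞) (f : BTree → ℝ≥0∞) :
    treeMean (fun t => a * f t) = a * treeMean f := by
  simp only [treeMean, mul_left_comm _ a, ENNReal.tsum_mul_left]

lemma treeMean_const (a : ℝ≥0∞) : treeMean (fun _ => a) = a := by
  simp only [treeMean, ENNReal.tsum_mul_right, tsum_bgwWeight, one_mul]

lemma treeMean_eq_forestMean (f : BTree → ℝ≥0∞) :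
    treeMean f = 2⁻¹ * forestMean (fun l => f (.node .white l)) +
      2⁻¹ * forestMean (fun l => f (.node .black l)) := by
  rw [treeMean, ← BTree.equivProd.tsum_eq, ENNReal.tsum_prod', tsum_fintype]
  have h : ∀ c, ∑' l, (BTree.equivProd (c, l)).bgwWeight * f (BTree.equivProd (c, l)) =
      2⁻¹ * forestMean (fun l => f (.node c l)) := by
    intro c
    rw [forestMean, ← ENNReal.tsum_mul_left]
    refine tsum_congr fun l => ?_
    change (BTree.node c l).bgwWeight * f (BTree.node c l) = _
    rw [BTree.bgwWeight_node]
    ring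
  have h2 : (Finset.univ : Finset Colour) = {.white, .black} := rfl
  rw [h2, Finset.sum_pair (by simp), h, h]

lemma treeMean_children (f : List BTree → ℝ≥0∞) :
    treeMean (fun t => f t.children) = forestMean f := by
  rw [treeMean_eq_forestMean]
  simp only [BTree.children]
  rw [← add_mul, ENNReal.inv_two_add_inv_two, one_mul]

lemma forestMean_const (a : ℝ≥0∞) : forestMean (fun _ => a) = a := by
  rw [← treeMean_children fun _ => a, treeMean_const]

/-- A random forest is empty with probability `1/2`, and otherwise it is a Galton-Watson tree
followed by an independent random forest. -/
lemma forestMean_eq (f : List BTree → ℝ≥0∞) :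
    forestMean f = 2⁻¹ * f [] + 2⁻¹ * treeMean fun t => forestMean fun l => f (t :: l) := by
  let e : Unit ⊕ (BTree × List BTree) ≃ List BTree :=
    { toFun := Sum.elim (fun _ => []) fun p => p.1 :: p.2
      invFun := fun | [] => .inl () | t :: l => .inr (t, l)
      left_inv := by rintro (_ | _) <;> rfl
      right_inv := by rintro (_ | _) <;> rfl }
  rw [forestMean, ← e.tsum_eq, ENNReal.summable.tsum_sum ENNReal.summable, ENNReal.tsum_prod',
    tsum_fintype, Fintype.sum_unique, treeMean, ← ENNReal.tsum_mul_left]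
  simp only [forestMean, ← ENNReal.tsum_mul_left]
  congr 1
  · simp [e]
  · refine tsum_congr fun t => tsum_congr fun l => ?_
    simp only [e, Equiv.coe_fn_mk, Sum.elim_inr, List.length_cons, List.map_cons, List.prod_cons]
    ring

lemma forestMean_reverse (f : List BTree → ℝ≥0∞) :
    forestMean (fun l => f l.reverse) = forestMean f := by
  rw [forestMean, forestMean, ← (List.reverse_involutive.toPerm List.reverse).tsum_eq]
  simp

/-- The rightmost tree of a nonempty random forest is a Galton-Watson tree. -/
lemma treeMean_forestMean_getLast (f : BTree → ℝ≥0∞) :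
    treeMean (fun t => forestMean fun l => f ((t :: l).getLast (by simp))) = treeMean f := by
  have h := forestMean_reverse fun l => (l.head?.map f).getD 0
  rw [forestMean_eq, forestMean_eq] at h
  have e : ∀ (t : BTree) (l : List BTree), ((t :: l).reverse.head?.map f).getD 0 =
      f ((t :: l).getLast (by simp)) := by
    intro t l
    rw [List.head?_reverse, List.getLast?_eq_some_getLast (by simp)]
    rfl
  simp only [e, List.reverse_nil, List.head?_nil, Option.map_none, Option.getD_none, mul_zero,
    zero_add, List.head?_cons, Option.map_some, Option.getD_some, forestMean_const] at h
  exact (ENNReal.mul_right_inj (by simp) (by simp)).1 h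

lemma vertexMean_const (a : ℝ≥0∞) : vertexMean (fun _ => a) = a := by
  rw [vertexMean, forestMean_const, ← add_mul, ENNReal.inv_two_add_inv_two, one_mul]

lemma lineMean_const (tail : List PathVertex) (k : ℕ) (a : ℝ≥0∞) :
    lineMean tail k (fun _ => a) = a := by
  induction k with
  | zero => rfl
  | succ k ih => simp only [lineMean, ih, vertexMean_const]

/-! ### The probability that the algorithm follows a given sequence of states -/

/-- The indicator function of the event that the algorithm goes successively through the states
`as`, starting from the triple `o`. -/
def follow : List State → Option Triple → ℝ≥0∞
  | [], _ => 1
  | _ :: _, none => 0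
  | a :: as, some p => if p.state = a then follow as (step p) else 0

lemma follow_eq_ite (as : List State) (u : ℕ → Option Triple)
    (hu : ∀ i, u (i + 1) = (u i).bind step)
    [Decidable (∀ i : Fin as.length, (u i).map Triple.state = some (as.get i))] :
    follow as (u 0) =
      if ∀ i : Fin as.length, (u i).map Triple.state = some (as.get i) then 1 else 0 := by
  classical
  induction as generalizing u with
  | nil => simp [follow]
  | cons a as ih =>
    have hs := ih (fun i => u (i + 1)) fun i => hu (i + 1)
    simp only [List.length_cons, Fin.forall_fin_succ]
    cases h : u 0 with
    | none => simp [follow, h]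
    | some p =>
      have h1 : u (0 + 1) = step p := by rw [hu, h]; rfl
      rw [h1] at hs
      rw [follow, hs]
      by_cases hp : p.state = a <;> simp [h, hp]

/-- The entries of the transition matrix. -/
noncomputable def transProb : State → State → ℝ≥0
  | .w0 => fun | .w0 => 1 / 4 | .wPos => 1 / 4 | .b => 1 / 2 | .j => 0
  | .wPos => fun | .w0 => 1 / 16 | .wPos => 5 / 16 | .b => 5 / 8 | .j => 0
  | .b => fun | .w0 => 3 / 32 | .wPos => 7 / 32 | .b => 7 / 16 | .j => 1 / 4
  | .j => fun | .w0 => 1 / 8 | .wPos => 1 / 8 | .b => 1 / 4 | .j => 1 / 2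

/-- The probability that the Markov chain started at `s` goes successively through the states
`as` after its initial time. -/
noncomputable def chainProb : State → List State → ℝ≥0
  | _, [] => 1
  | s, a :: as => transProb s a * chainProb a as

lemma inv_two_eq_coe : (2⁻¹ : ℝ≥0∞) = ((2⁻¹ : ℝ≥0) : ℝ≥0∞) := by simp

/-- The properties of `K t`, the probability that the algorithm, on arriving at a vertex `x` with
`τ^x = t`, is in the state `a` and goes on in a prescribed way, where `C` is the probability that
it goes on in that way from the state `a`. From the states `w₀` and `b`, the future does not depend
on `t`; from the state `w_{>0}` it depends on the rightmost child only. -/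
structure IsLandingValue (a : State) (C : ℝ≥0) (K : BTree → ℝ≥0∞) : Prop where
  black : ∀ l, K (.node .black l) = if a = .b then (C : ℝ≥0∞) else 0
  leaf : K (.node .white []) = if a = .w0 then (C : ℝ≥0∞) else 0
  white : ∃ H : BTree → ℝ≥0∞, treeMean H = (if a = .wPos then (C : ℝ≥0∞) else 0) ∧
    ∀ t l, K (.node .white (t :: l)) = H ((t :: l).getLast (by simp))

namespace IsLandingValue

variable {a : State} {C : ℝ≥0} {K : BTree → ℝ≥0∞}

lemma treeMean_white (h : IsLandingValue a C K) :
    treeMean (fun t => forestMean fun l => K (.node .white (t :: l))) =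
      if a = .wPos then (C : ℝ≥0∞) else 0 := by
  obtain ⟨H, hH, hK⟩ := h.white
  simp only [hK, treeMean_forestMean_getLast, hH]

lemma treeMean_treeMean_white (h : IsLandingValue a C K) :
    treeMean (fun t => treeMean fun t' => forestMean fun l => K (.node .white (t :: t' :: l))) =
      if a = .wPos then (C : ℝ≥0∞) else 0 := by
  obtain ⟨H, hH, hK⟩ := h.white
  simp only [hK, List.getLast_cons_cons, treeMean_forestMean_getLast, hH, treeMean_const]

/-- The transition law on arriving at the root of a new Galton-Watson tree, which is the row `w₀` of
the matrix. -/
lemma treeMean_eq (h : IsLandingValue a C K) :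
    treeMean K = (transProb .w0 a * C : ℝ≥0) := by
  rw [treeMean_eq_forestMean, forestMean_eq, h.treeMean_white, h.leaf]
  simp only [h.black, forestMean_const]
  rw [inv_two_eq_coe]
  cases a <;> simp only [transProb, reduceCtorEq, if_true, if_false] <;> norm_cast <;> ring

/-- The transition from the state `w₀`. -/
lemma vertexMean_eq (h : IsLandingValue a C K) :
    vertexMean (fun v => K (.node v.colour v.right)) = (transProb .w0 a * C : ℝ≥0) := by
  rw [← h.treeMean_eq, treeMean_eq_forestMean]
  rfl

lemma merge_black (h : IsLandingValue a C K) (t : BTree) :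
    K (.node (mergeColour .black t.colour) t.children) = if a = .b then (C : ℝ≥0∞) else 0 := by
  rw [← h.black t.children]
  cases t.colour <;> rfl

lemma merge_white (t : BTree) : K (.node (mergeColour .white t.colour) t.children) = K t := by
  obtain ⟨_ | _, l⟩ := t <;> rfl

/-- The transition from the state `w_{>0}`, where `S t v` is the probability that the algorithm,
at a white vertex with rightmost subtree `t` and parent `v`, goes on in the prescribed way. -/
lemma treeMean_vertexMean_eq (h : IsLandingValue a C K) (S : BTree → PathVertex → ℝ≥0∞)
    (hnil : ∀ t c, S t ⟨c, [], []⟩ = K (.node (mergeColour c t.colour) t.children))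
    (hcons : ∀ t c t' l, S t ⟨c, [], t' :: l⟩ = K (.node c (t' :: l))) :
    treeMean (fun t => vertexMean (S t)) = (transProb .wPos a * C : ℝ≥0) := by
  simp only [vertexMean, forestMean_eq (fun l => S _ ⟨_, [], l⟩), hnil, hcons, merge_white,
    h.merge_black, h.treeMean_white, h.black, treeMean_add, treeMean_const_mul, treeMean_const, forestMean_const,
    h.treeMean_eq]
  rw [inv_two_eq_coe]
  cases a <;> simp only [transProb, reduceCtorEq, if_true, if_false] <;> norm_cast <;> ring

/-- The transition from the state `b`, where `S v` is the probability that the algorithm, at a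
black vertex with parent `v`, goes on in the prescribed way. -/
lemma vertexMean_eq_of_jump (h : IsLandingValue a C K) (S : PathVertex → ℝ≥0∞)
    (hnil : ∀ c, S ⟨c, [], []⟩ = (transProb .j a * C : ℝ≥0))
    (hone : ∀ c t, S ⟨c, [], [t]⟩ = K (.node (mergeColour c t.colour) t.children))
    (htwo : ∀ c t t' l, S ⟨c, [], t :: t' :: l⟩ = K (.node c (t :: t' :: l))) :
    vertexMean S = (transProb .b a * C : ℝ≥0) := by
  have e : ∀ c, forestMean (fun l => S ⟨c, [], l⟩) = 2⁻¹ * S ⟨c, [], []⟩ +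
      2⁻¹ * (2⁻¹ * treeMean (fun t => S ⟨c, [], [t]⟩) +
        2⁻¹ * treeMean fun t => treeMean fun t' => forestMean fun l => S ⟨c, [], t :: t' :: l⟩) := by
    intro c
    rw [forestMean_eq]
    simp only [forestMean_eq (fun l => S ⟨c, [], _ :: l⟩), treeMean_add, treeMean_const_mul]
  simp only [vertexMean, e, hnil, hone, htwo, merge_white, h.merge_black,
    h.treeMean_treeMean_white, h.black, treeMean_const, forestMean_const, h.treeMean_eq]
  rw [inv_two_eq_coe]
  cases a <;> simp only [transProb, reduceCtorEq, if_true, if_false] <;> norm_cast <;> ring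

/-- The transition from the state `j`, where `S g` is the probability that the algorithm, when it
jumps from a child of a child of `g`, goes on in the prescribed way, and where `R t v` is the
probability of this when the jump leads to the root of `t`, the parent of which becomes `v`. -/
lemma vertexMean_jump (h : IsLandingValue a C K) (S : PathVertex → ℝ≥0∞)
    (R : BTree → PathVertex → ℝ≥0∞) (hR : ∀ t, vertexMean (R t) = K t)
    (hnil : ∀ c, S ⟨c, [], []⟩ = if a = .j then (C : ℝ≥0∞) else 0)
    (hcons : ∀ c t l, S ⟨c, [], t :: l⟩ = R t ⟨c, [], l⟩) :
    vertexMean S = (transProb .j a * C : ℝ≥0) := by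
  have e : vertexMean S =
      2⁻¹ * (if a = .j then (C : ℝ≥0∞) else 0) + 2⁻¹ * treeMean fun t => vertexMean (R t) := by
    simp only [vertexMean, forestMean_eq (fun l => S ⟨_, [], l⟩), hnil, hcons, treeMean_add,
      treeMean_const_mul, mul_add]
    rw [add_add_add_comm, ← add_mul, ENNReal.inv_two_add_inv_two, one_mul]
  simp only [e, hR, h.treeMean_eq]
  rw [inv_two_eq_coe]
  cases a <;> simp only [transProb, reduceCtorEq, if_true, if_false] <;> norm_cast <;> ring

end IsLandingValue

/-! ### The states of the algorithm at random ancestors -/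

/-- In the state `w_{>0}`, the algorithm depends on the rightmost child only. -/
lemma step_wPos_congr {x y : BTree} (h : x.children.getLast? = y.children.getLast?)
    (l : List PathVertex) : step ⟨⟨x, l⟩, .wPos⟩ = step ⟨⟨y, l⟩, .wPos⟩ := by
  cases l with
  | nil => rfl
  | cons v l => simp only [step, h]

/-- The probability that the algorithm goes on through the states `as` is the one given by the
Markov chain, whatever the irrelevant part of the tree is: this is the subtree of the current
vertex `x` in the states `w₀` and `b`, all of it but the subtree of the rightmost child in the
state `w_{>0}`, and the subtree of `x` together with its parent in the state `j`. The last
`tail.length` ancestors are never looked at. -/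
structure FollowsChain (tail : List PathVertex) (as : List State) : Prop where
  w0 : ∀ x, lineMean tail (as.length + 1) (fun l => follow as (step ⟨⟨x, l⟩, .w0⟩)) =
    chainProb .w0 as
  wPos : treeMean (fun r => lineMean tail (as.length + 1)
    fun l => follow as (step ⟨⟨.node .white [r], l⟩, .wPos⟩)) = chainProb .wPos as
  b : ∀ x, lineMean tail (as.length + 1) (fun l => follow as (step ⟨⟨x, l⟩, .b⟩)) =
    chainProb .b as
  j : ∀ x v, lineMean tail as.length (fun l => follow as (step ⟨⟨x, v :: l⟩, .j⟩)) =
    chainProb .j as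

lemma FollowsChain.isLandingValue {tail : List PathVertex} {as : List State}
    (h : FollowsChain tail as) (a : State) :
    IsLandingValue a (chainProb a as) fun t =>
      lineMean tail (as.length + 1) fun l => follow (a :: as) (some (land ⟨t, l⟩)) where
  black x := by
    simp only [follow, land, vertexState, eq_comm (a := State.b)]
    split_ifs with ha
    · rw [ha, h.b]
    · exact lineMean_const ..
  leaf := by
    simp only [follow, land, vertexState, eq_comm (a := State.w0)]
    split_ifs with ha
    · rw [ha, h.w0]
    · exact lineMean_const ..
  white := by
    refine ⟨fun r => lineMean tail (as.length + 1) fun l =>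
      follow (a :: as) (some (land ⟨.node .white [r], l⟩)), ?_, fun t l => ?_⟩
    · simp only [follow, land, vertexState, eq_comm (a := State.wPos)]
      split_ifs with ha
      · rw [ha, h.wPos]
      · simp only [lineMean_const, treeMean_const]
    · simp only [follow, land, vertexState]
      congr! 4 with l'
      exact step_wPos_congr (by simp [BTree.children, List.getLast?_eq_some_getLast]) _

/-- The induction on the sequence of states: each step consumes one random ancestor, and what it
reveals is either discarded or makes up the subtree of the new vertex. -/
theorem followsChain (tail : List PathVertex) (as : List State) : FollowsChain tail as := by
  induction as with
  | nil =>
    refine ⟨fun x => ?_, ?_, fun x => ?_, fun x v => ?_⟩ <;>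
      simp [follow, chainProb, lineMean_const, treeMean_const]
  | cons a as ih =>
    have hK := ih.isLandingValue a
    have hj : ∀ v, lineMean tail (as.length + 1) (fun l => follow (a :: as) (jump v l)) =
        (transProb .j a * chainProb a as : ℝ≥0) := by
      intro v
      -- On landing, the first tree to the right of `g` is used up, and what is to its right is again
      -- a random forest: `g` is as good as a new vertex of the spine.
      refine hK.vertexMean_jump _ (fun t g => lineMean tail as.length fun l =>
        follow (a :: as) (some (land ⟨t, g :: l⟩))) (fun t => rfl) (fun c => ?_) fun c t l => rfl
      simp only [jump, follow, eq_comm (a := State.j)]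
      split_ifs with ha
      · rw [ha]
        exact ih.j (.node v.colour (v.left ++ v.right)) _
      · exact lineMean_const ..
    exact
      { w0 := fun x => hK.vertexMean_eq
        wPos := hK.treeMean_vertexMean_eq _ (fun t c => rfl) fun t c t' l => rfl
        b := fun x => hK.vertexMean_eq_of_jump _ (fun c => hj _) (fun c t => rfl)
          fun c t t' l => rfl
        j := fun x v => hj v }

/-! ### Functions of finitely many independent coordinates -/

lemma measurable_of_dependsOn {α β : Type*} [MeasurableSpace α] [Countable α]
    [DiscreteMeasurableSpace α] [MeasurableSpace β] [Nonempty β] {s : Finset ℕ}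
    {φ : (ℕ → α) → β} (hφ : DependsOn φ s) : Measurable φ := by
  obtain ⟨ψ, rfl⟩ := dependsOn_iff_exists_comp.1 hφ
  have hm : Measurable fun (T : ℕ → α) (j : (s : Set ℕ)) => T j := by fun_prop
  exact Measurable.comp (measurable_of_countable ψ) hm

/-- A coordinate is independent of any function of other coordinates. -/
lemma lintegral_infinitePi_of_dependsOn {α β : Type*} [MeasurableSpace α] [Countable α]
    [DiscreteMeasurableSpace α] [Nonempty β] (ν : Measure α) [IsProbabilityMeasure ν]
    {s : Finset ℕ} {φ : (ℕ → α) → β} (hφ : DependsOn φ s) {i : ℕ} (hi : i ∉ s)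
    (g : α → β → ℝ≥0∞) :
    ∫⁻ T, g (T i) (φ T) ∂Measure.infinitePi (fun _ : ℕ => ν) =
      ∫⁻ v, ∫⁻ T, g v (φ T) ∂Measure.infinitePi (fun _ : ℕ => ν) ∂ν := by
  obtain ⟨ψ, rfl⟩ := dependsOn_iff_exists_comp.1 hφ
  set μ := Measure.infinitePi (fun _ : ℕ => ν)
  have h1 : iIndepFun (fun (i : ℕ) (T : ℕ → α) => T i) μ :=
    iIndepFun_infinitePi (X := fun _ => id) fun _ => measurable_id
  have h2 := h1.indepFun_finset {i} s (by simpa using hi) fun i => measurable_pi_apply i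
  have h3 : IndepFun (fun T : ℕ → α => T i) (fun T (j : s) => T j) μ :=
    h2.comp (φ := fun x : ({i} : Finset ℕ) → α => x ⟨i, by simp⟩) (ψ := id) (measurable_pi_apply _)
      measurable_id
  have hm : Measurable fun (T : ℕ → α) (j : s) => T j := by fun_prop
  have h4 := h3.map_prod_eq_prod_map_map (measurable_pi_apply i).aemeasurable hm.aemeasurable
  have h5 : μ.map (fun T => T i) = ν := Measure.infinitePi_map_eval (fun _ : ℕ => ν) i
  have hg : Measurable fun p : α × (s → α) => g p.1 (ψ p.2) := measurable_of_countable _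
  calc ∫⁻ T, g (T i) (ψ (fun j => T j)) ∂μ
      = ∫⁻ p, g p.1 (ψ p.2) ∂μ.map (fun T => (T i, fun j : s => T j)) :=
        (lintegral_map hg ((measurable_pi_apply i).prodMk hm)).symm
    _ = ∫⁻ v, ∫⁻ r, g v (ψ r) ∂(μ.map fun T (j : s) => T j) ∂ν := by
        have := Measure.isProbabilityMeasure_map (μ := μ) hm.aemeasurable
        rw [h4, h5, lintegral_prod _ hg.aemeasurable]
        rfl
    _ = _ := by
        refine lintegral_congr fun v => ?_
        exact lintegral_map (f := fun r => g v (ψ r)) (measurable_of_countable _) hm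

/-! ### The spine and the first states of the algorithm -/

instance : DiscreteMeasurableSpace Colour := ⟨fun _ => trivial⟩
instance : DiscreteMeasurableSpace BTree := ⟨fun _ => trivial⟩
instance : DiscreteMeasurableSpace PathVertex := ⟨fun _ => trivial⟩
instance : DiscreteMeasurableSpace State := ⟨fun _ => trivial⟩
instance : DiscreteMeasurableSpace (Option State) := ⟨fun _ => trivial⟩
instance : Nonempty State := ⟨.w0⟩

lemma bgwWeight_ne_zero (t : BTree) : t.bgwWeight ≠ 0 := by
  induction t using BTree.rec
    (motive_2 := fun l => (l.map BTree.bgwWeight).prod ≠ 0) with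
  | node c l ih => rw [BTree.bgwWeight_node]; simp [ih]
  | nil => simp
  | cons t l iht ihl => simp [iht, ihl]

/-- There are countably many trees, since all of them have positive weight and the sum of their
weights is finite. -/
instance : Countable BTree := by
  have h : bgw.support = Set.univ := Set.eq_univ_of_forall fun t => bgwWeight_ne_zero t
  exact Set.countable_univ_iff.1 (h ▸ bgw.support_countable)

instance : Countable PathVertex :=
  Function.Injective.countable (f := fun v : PathVertex => (v.colour, v.left, v.right))
    (by rintro ⟨_, _, _⟩ ⟨_, _, _⟩ h; simpa using h)

/-- The law of a vertex of the spine, with what is attached to it. -/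
noncomputable def vertexLaw : Measure PathVertex :=
  ((PMF.uniformOfFintype Colour).toMeasure.prod (bgw.toMeasure.prod bgw.toMeasure)).map
    fun p => attach p.1 p.2.1 p.2.2

instance : IsProbabilityMeasure vertexLaw :=
  Measure.isProbabilityMeasure_map (measurable_of_countable _).aemeasurable

lemma tInftyLaw_eq : tInftyLaw = Measure.infinitePi fun _ : ℕ => vertexLaw :=
  Measure.infinitePi_map_pi _ (X := fun _ : ℕ => Colour × BTree × BTree)
    (f := fun _ p => attach p.1 p.2.1 p.2.2) fun _ => measurable_of_countable _

/-- Erase what is attached to the left of a vertex. -/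
def PathVertex.trim (v : PathVertex) : PathVertex := ⟨v.colour, [], v.right⟩

lemma lintegral_bgw (f : BTree → ℝ≥0∞) : ∫⁻ t, f t ∂bgw.toMeasure = treeMean f := by
  rw [lintegral_countable', treeMean]
  refine tsum_congr fun t => ?_
  rw [PMF.toMeasure_apply_singleton _ _ (.of_discrete), mul_comm]
  rfl

lemma lintegral_vertexLaw (f : PathVertex → ℝ≥0∞) :
    ∫⁻ v, f v.trim ∂vertexLaw = vertexMean f := by
  rw [vertexLaw, lintegral_map (measurable_of_countable _) (measurable_of_countable _),
    lintegral_prod _ (measurable_of_countable _).aemeasurable, lintegral_fintype]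
  have h : ∀ c, ∫⁻ p : BTree × BTree, f (attach c p.1 p.2).trim
      ∂bgw.toMeasure.prod bgw.toMeasure = forestMean fun l => f ⟨c, [], l⟩ := by
    intro c
    rw [lintegral_prod _ (measurable_of_countable _).aemeasurable]
    simp only [lintegral_bgw]
    exact (treeMean_const _).trans (treeMean_children fun l => f ⟨c, [], l⟩)
  have h2 : (Finset.univ : Finset Colour) = {.white, .black} := rfl
  have h3 : Fintype.card Colour = 2 := rfl
  simp only [h, PMF.toMeasure_apply_singleton _ _ (MeasurableSet.of_discrete),
    PMF.uniformOfFintype_apply, h3, h2]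
  rw [Finset.sum_pair (by simp), vertexMean]
  simp only [Nat.cast_ofNat, mul_comm]

/-- The vertices `v_k, …, v_1` of the spine, with what is attached to their right. -/
def trimmedLine (T : SpineTree) : ℕ → List PathVertex
  | 0 => []
  | k + 1 => (T (k + 1)).trim :: trimmedLine T k

lemma dependsOn_trimmedLine (k : ℕ) :
    DependsOn (fun T => trimmedLine T k) (Finset.Icc 1 k : Set ℕ) := by
  intro T T' h
  induction k with
  | zero => rfl
  | succ k ih =>
    have hk : trimmedLine T k = trimmedLine T' k := ih fun i hi => h i (by simp at hi ⊢; omega)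
    simp only [trimmedLine, hk, h (k + 1) (by simp)]

lemma lintegral_trimmedLine (tail : List PathVertex) (k : ℕ) (f : List PathVertex → ℝ≥0∞) :
    ∫⁻ T, f (trimmedLine T k ++ tail) ∂tInftyLaw = lineMean tail k f := by
  rw [tInftyLaw_eq]
  induction k generalizing f with
  | zero => simp [trimmedLine, lineMean]
  | succ k ih =>
    rw [lineMean, ← lintegral_vertexLaw]
    refine (lintegral_infinitePi_of_dependsOn vertexLaw (dependsOn_trimmedLine k)
      (i := k + 1) (by simp) fun v l => f (v.trim :: (l ++ tail))).trans ?_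
    exact lintegral_congr fun v => ih fun l => f (v.trim :: l)

/-- What remains of the root of the spine in `τ°`, once everything on its left is erased. -/
def circRoot (v : PathVertex) : PathVertex := ⟨.white, [], v.right ++ [whiteLeaf]⟩

lemma map_trim_circAncestors (T : SpineTree) (n : ℕ) :
    (circAncestors ((List.range (n + 1)).reverse.map T)).map PathVertex.trim =
      trimmedLine T n ++ [circRoot (T 0)] := by
  induction n with
  | zero => rfl
  | succ n ih =>
    rw [List.range_succ, List.reverse_append, List.reverse_singleton, List.singleton_append,
      List.map_cons]
    rw [List.range_succ, List.reverse_append, List.reverse_singleton, List.singleton_append,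
      List.map_cons] at ih ⊢
    rw [circAncestors, List.map_cons, ih]
    rfl

/-- The algorithm starts as if `v_n` had been reached from a child of it in the state `w₀`. -/
lemma run_cut_zero (n : ℕ) (T : SpineTree) :
    run (circ (cut (n + 1) T)) 0 =
      step ⟨⟨whiteLeaf, trimmedLine T (n + 1) ++ [circRoot (T 0)]⟩, .w0⟩ := by
  have h : circ (cut (n + 1) T) = ⟨.node (T (n + 1)).colour (T (n + 1)).right,
      circAncestors ((List.range (n + 1)).reverse.map T)⟩ := by
    simp [cut, List.range_succ, circ]
  rw [h]
  change some (land ⟨_, (circAncestors ((List.range (n + 1)).reverse.map T)).map PathVertex.trim⟩)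
    = _
  rw [map_trim_circAncestors]
  rfl

lemma lintegral_follow (as : List State) :
    ∫⁻ T, follow as (run (circ (cut (as.length + 1) T)) 0) ∂tInftyLaw = chainProb .w0 as := by
  simp only [run_cut_zero]
  rw [tInftyLaw_eq]
  refine (lintegral_infinitePi_of_dependsOn vertexLaw (dependsOn_trimmedLine (as.length + 1))
    (i := 0) (by simp)
    fun v l => follow as (step ⟨⟨whiteLeaf, l ++ [circRoot v]⟩, .w0⟩)).trans ?_
  rw [← tInftyLaw_eq]
  simp only [lintegral_trimmedLine _ _ fun l => follow as (step ⟨⟨whiteLeaf, l⟩, .w0⟩),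
    (followsChain _ as).w0]
  simp

lemma measurable_runState_cut (n : ℕ) (ι : Type*) (e : ι → ℕ) :
    Measurable fun (T : SpineTree) (i : ι) => runState (circ (cut n T)) (e i) := by
  refine measurable_of_dependsOn (s := Finset.range (n + 1)) fun T T' h => ?_
  have : cut n T = cut n T' := by
    rw [cut, cut, h n (by simp)]
    congr 1
    exact List.map_congr_left fun i hi => h i (by simp at hi ⊢; omega)
  simp only [this]

lemma tInftyLaw_runState (m : ℕ) (a : Fin m → State) :
    tInftyLaw {T | (fun i : Fin m => runState (circ (cut (m + 1) T)) i) = fun i => some (a i)} =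
      chainProb .w0 (List.ofFn a) := by
  classical
  have hS : MeasurableSet {T : SpineTree |
      (fun i : Fin m => runState (circ (cut (m + 1) T)) i) = fun i => some (a i)} :=
    measurable_runState_cut (m + 1) (Fin m) (fun i => i) (MeasurableSet.singleton _)
  rw [← lintegral_follow, ← lintegral_indicator_one hS]
  refine lintegral_congr fun T => ?_
  rw [follow_eq_ite _ (run (circ (cut _ T))) fun i => rfl, Set.indicator_apply]
  simp [funext_iff, Fin.forall_iff, runState]

/-! ### The Markov chain -/

/-- The rows of the transition matrix, as probability distributions. -/
noncomputable def rowPMF (s : State) : PMF State :=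
  PMF.ofFintype (fun a => (transProb s a : ℝ≥0∞)) (by
    have h : (Finset.univ : Finset State) = {.w0, .wPos, .b, .j} := rfl
    rw [h]
    norm_cast
    cases s <;> simp [transProb] <;> field_simp <;> norm_num)

/-- The law of a random map from states to states, which sends independently each state `s` to a
state chosen according to the row `s` of the transition matrix. -/
noncomputable def updateLaw : Measure (State → State) := Measure.pi fun s => (rowPMF s).toMeasure

instance : IsProbabilityMeasure updateLaw := by unfold updateLaw; infer_instance

/-- The chain driven by the maps `ω 0, ω 1, …`. Its initial law is the row `w₀` of the transition
matrix. -/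
def chain : ℕ → (ℕ → State → State) → State
  | 0, ω => ω 0 .w0
  | i + 1, ω => ω (i + 1) (chain i ω)

/-- The sequence `s, a 0, a 1, …`. -/
def prepend (s : State) (a : ℕ → State) : ℕ → State
  | 0 => s
  | i + 1 => a i

lemma updateLaw_apply (s s' : State) : updateLaw {e | e s = s'} = transProb s s' := by
  have h := (measurePreserving_eval (fun s => (rowPMF s).toMeasure) s).measure_preimage
    (MeasurableSet.of_discrete (s := {s'})).nullMeasurableSet
  refine h.trans ?_
  rw [PMF.toMeasure_apply_singleton _ _ .of_discrete]
  rfl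

lemma measurable_chain (i : ℕ) : Measurable (chain i) := by
  induction i with
  | zero =>
    exact Measurable.comp (g := fun e : State → State => e .w0) (measurable_of_countable _)
      (measurable_pi_apply 0)
  | succ i ih =>
    exact Measurable.comp (g := fun p : (State → State) × State => p.1 p.2)
      (measurable_of_countable _) ((measurable_pi_apply (i + 1)).prodMk ih)

lemma measurable_some_chain (m : ℕ) :
    Measurable fun (ω : ℕ → State → State) (i : Fin m) => some (chain i ω) :=
  measurable_pi_lambda _ fun i => (measurable_of_countable some).comp (measurable_chain i)

lemma infinitePi_chain (a : ℕ → State) (m : ℕ) :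
    Measure.infinitePi (fun _ : ℕ => updateLaw) {ω | ∀ i < m, chain i ω = a i} =
      (∏ i ∈ Finset.range m, transProb (prepend .w0 a i) (a i) : ℝ≥0) := by
  have h : {ω | ∀ i < m, chain i ω = a i} =
      Set.pi (Finset.range m) fun i => {e : State → State | e (prepend .w0 a i) = a i} := by
    ext ω
    simp only [Set.mem_ofPred_eq, Set.mem_pi, Finset.coe_range, Set.mem_Iio]
    induction m with
    | zero => simp
    | succ m ih =>
      rw [Nat.forall_lt_succ_right, Nat.forall_lt_succ_right, ← ih]
      refine and_congr_right fun hm => ?_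
      cases m with
      | zero => rfl
      | succ m => rw [chain, hm m (by omega), prepend]
  rw [h, Measure.infinitePi_pi _ fun _ _ => .of_discrete]
  simp [updateLaw_apply]

lemma chainProb_ofFn (s : State) (a : ℕ → State) (m : ℕ) :
    chainProb s (List.ofFn fun i : Fin m => a i) =
      ∏ i ∈ Finset.range m, transProb (prepend s a i) (a i) := by
  induction m generalizing s a with
  | zero => simp [chainProb]
  | succ m ih =>
    rw [List.ofFn_succ, chainProb, Finset.prod_range_succ', mul_comm]
    refine congrArg (· * _) ((ih (a 0) fun i => a (i + 1)).trans ?_)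
    refine Finset.prod_congr rfl fun i _ => ?_
    cases i <;> rfl

lemma coe_transProb (s a : State) : (transProb s a : ℝ) = transitionMatrix s a := by
  cases s <;> cases a <;> simp [transProb, transitionMatrix]

lemma isMarkovChain_chain :
    IsMarkovChain (Measure.infinitePi fun _ : ℕ => updateLaw) chain initialLaw
      transitionMatrix where
  measurable := measurable_chain
  initial s := by
    have h := infinitePi_chain (fun _ => s) 1
    simp only [Nat.lt_one_iff, forall_eq, Finset.range_one, Finset.prod_singleton, prepend] at h
    rw [Measure.real, h, ENNReal.coe_toReal, coe_transProb]
    cases s <;> rfl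
  transition m a := by
    have h1 := infinitePi_chain a (m + 1)
    have h2 := infinitePi_chain a (m + 2)
    rw [Finset.prod_range_succ] at h2
    simp only [Nat.lt_succ_iff] at h1
    have e : ∀ i, i < m + 2 ↔ i ≤ m + 1 := fun i => by omega
    simp only [e] at h2
    rw [Measure.real, Measure.real, h1, h2, ← coe_transProb]
    simp [prepend]

/-- A measure that charges each point at least as much as a probability measure `μ`, on a finite
space, is equal to `μ` if its total mass is one. -/
lemma eq_of_forall_singleton_le {α : Type*} [MeasurableSpace α] [Finite α]
    [MeasurableSingletonClass α] {μ ν : Measure α} [IsProbabilityMeasure μ]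
    [IsProbabilityMeasure ν] (h : ∀ x, μ {x} ≤ ν {x}) : μ = ν := by
  refine Measure.eq_of_le_of_isProbabilityMeasure (Measure.le_iff.2 fun s _ => ?_)
  have hs := s.toFinite
  rw [← hs.coe_toFinset, ← sum_measure_singleton, ← sum_measure_singleton]
  exact Finset.sum_le_sum fun x _ => h x

/-- The first `m` states of the algorithm have the law of the first `m` states of the chain. The
sequences of states with an undefined entry need not be considered separately, because the
defined ones have total probability one already under the law of the chain. -/
lemma map_runState_eq_map_chain (m : ℕ) :
    tInftyLaw.map (fun T (i : Fin m) => runState (circ (cut (m + 1) T)) i) =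
      (Measure.infinitePi fun _ : ℕ => updateLaw).map fun ω (i : Fin m) => some (chain i ω) := by
  have hm1 := measurable_runState_cut (m + 1) (Fin m) fun i => i
  have hm2 := measurable_some_chain m
  have : IsProbabilityMeasure tInftyLaw := tInftyLaw_eq ▸ inferInstance
  have := Measure.isProbabilityMeasure_map (μ := tInftyLaw) hm1.aemeasurable
  have := Measure.isProbabilityMeasure_map
    (μ := Measure.infinitePi fun _ : ℕ => updateLaw) hm2.aemeasurable
  refine (eq_of_forall_singleton_le fun x => ?_).symm
  rw [Measure.map_apply hm1 (.singleton _), Measure.map_apply hm2 (.singleton _)]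
  by_cases hx : ∃ a : Fin m → State, x = fun i => some (a i)
  · obtain ⟨a, rfl⟩ := hx
    refine le_of_eq ?_
    -- The sequence `a` is extended by an arbitrary value.
    set a' : ℕ → State := fun i => if h : i < m then a ⟨i, h⟩ else .w0 with ha'
    have hab : a = fun i : Fin m => a' i := by
      ext i
      simp [ha']
    refine Eq.trans ?_ (tInftyLaw_runState m a).symm
    rw [hab, chainProb_ofFn, ← infinitePi_chain]
    congr 1
    ext ω
    simp [funext_iff, Fin.forall_iff]
  · refine (measure_mono_null (t := ∅) (fun ω hω => hx ⟨fun i => chain i ω, ?_⟩) (by simp)).trans_le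
      zero_le
    exact (Set.mem_singleton_iff.1 hω).symm

end GeodesicAlgorithm

theorem mainTheorem3 {Ω : Type*} [MeasurableSpace Ω] (P : Measure Ω)
    (T : Ω → GeodesicAlgorithm.SpineTree)
    (hT : HasLaw T GeodesicAlgorithm.tInftyLaw P) :
    ∃ (Ω' : Type) (_ : MeasurableSpace Ω') (Q : Measure Ω')
      (X : ℕ → Ω' → GeodesicAlgorithm.State),
      IsProbabilityMeasure Q ∧
      GeodesicAlgorithm.IsMarkovChain Q X
        GeodesicAlgorithm.initialLaw GeodesicAlgorithm.transitionMatrix ∧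
      ∀ n : ℕ, 0 < n →
        IdentDistrib
          (fun ω (i : Fin (n - 1)) =>
            GeodesicAlgorithm.runState
              (GeodesicAlgorithm.circ (GeodesicAlgorithm.cut n (T ω))) i)
          (fun ω' (i : Fin (n - 1)) => some (X i ω')) P Q := by
  refine ⟨ℕ → GeodesicAlgorithm.State → GeodesicAlgorithm.State, inferInstance,
    Measure.infinitePi fun _ : ℕ => GeodesicAlgorithm.updateLaw, GeodesicAlgorithm.chain,
    inferInstance, GeodesicAlgorithm.isMarkovChain_chain, fun n hn => ?_⟩
  obtain ⟨m, rfl⟩ : ∃ m, n = m + 1 := ⟨n - 1, by omega⟩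
  have hm := GeodesicAlgorithm.measurable_runState_cut (m + 1) (Fin m) fun i => i
  have hm' := GeodesicAlgorithm.measurable_some_chain m
  refine ⟨hm.comp_aemeasurable hT.aemeasurable, hm'.aemeasurable, ?_⟩
  have h := GeodesicAlgorithm.map_runState_eq_map_chain m
  rw [← hT.map_eq, AEMeasurable.map_map_of_aemeasurable hm.aemeasurable hT.aemeasurable] at h
  exact h
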